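/- Let $R$ be a commutative ring with identity. An ideal $I$ of $R$ is called dense if $(0:_R I)=\{r\in R\mid Ir=0\}=0$, and semi-regular if it contains a finitely generated dense sub-ideal. The ring $R$ is called semi-regular coherent if every finitely generated semi-regular ideal of $R$ is finitely presented. An $R$-module $M$ is called semi-regular flat if $\operatorname{Tor}_1^R(R/I,M)=0$ for every finitely generated semi-regular ideal $I$ of $R$. A semi-regular flat preenvelope of an $R$-module $M$ is a homomorphism $f:M\to F$ with $F$ semi-regular flat such that every homomorphism $g:M\to F'$ with $F'$ semi-regular flat factors as $g=h\circ f$ for some homomorphism $h:F\to F'$; the class of semi-regular flat modules is called preenveloping if every $R$-module has a semi-regular flat preenvelope. Then $R$ is semi-regular coherent if and only if the class of all semi-regular flat $R$-modules is preenveloping. -/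

import Mathlib

open CategoryTheory

universe u

section

variable {R : Type u} [CommRing R]

/-- An ideal `I` is dense if `(0 :_R I) = {r ∈ R | I r = 0}` is `0`. -/
def Ideal.IsDenseIdeal (I : Ideal R) : Prop :=
  ∀ r : R, (∀ a ∈ I, a * r = 0) → r = 0

/-- An ideal is semi-regular if it contains a finitely generated dense sub-ideal. -/
def Ideal.IsSemiregularIdeal (I : Ideal R) : Prop :=
  ∃ J : Ideal R, J ≤ I ∧ J.FG ∧ J.IsDenseIdeal

end

/-- A ring is semi-regular coherent if every finitely generated semi-regular ideal is
finitely presented as a module. -/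
def IsSemiregularCoherent (R : Type u) [CommRing R] : Prop :=
  ∀ I : Ideal R, I.FG → I.IsSemiregularIdeal → Module.FinitePresentation R I

/-- The class of semi-regular flat modules: those `M` with `Tor₁(R/I, M) = 0` for every finitely
generated semi-regular ideal `I`. -/
def semiregularFlat (R : Type u) [CommRing R] : ObjectProperty (ModuleCat.{u} R) :=
  fun M => ∀ I : Ideal R, I.FG → I.IsSemiregularIdeal →
    Limits.IsZero (((Tor (ModuleCat.{u} R) 1).obj (ModuleCat.of R (R ⧸ I))).obj M)

/-- `f : M ⟶ F` is a preenvelope of `M` with respect to the class `P`: the module `F` lies in `P`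
and every morphism from `M` to an object of `P` factors through `f` (not necessarily uniquely). -/
def CategoryTheory.ObjectProperty.IsPreenvelope {R : Type u} [CommRing R]
    (P : ObjectProperty (ModuleCat.{u} R)) {M F : ModuleCat.{u} R} (f : M ⟶ F) : Prop :=
  P F ∧ ∀ (F' : ModuleCat.{u} R) (_ : P F') (g : M ⟶ F'), ∃ h : F ⟶ F', f ≫ h = g

/-- The class `P` is preenveloping if every module has a `P`-preenvelope. -/
def CategoryTheory.ObjectProperty.IsPreenveloping {R : Type u} [CommRing R]
    (P : ObjectProperty (ModuleCat.{u} R)) : Prop :=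
  ∀ M : ModuleCat.{u} R, ∃ (F : ModuleCat.{u} R) (f : M ⟶ F), P.IsPreenvelope f

/-! If I is generated by a finite family a, vanishing of Tor₁(R/I, M) means that every relation ∑
aᵢxᵢ = 0 in M is a consequence of syzygies of a (`isZero_tor_one_iff_isTrivialRelation`). When I is
finitely presented, one finite set of syzygies serves all modules, so the class is closed under
products (`RelationsTrivial.pi`). Maps out of M factor through members of bounded size
(`RelationsTrivial.exists_factorization`), and the product over a set of these is a preenvelope.
Conversely, preenvelopes force closure under products, and triviality of one tautological relation
in a power of R makes the syzygies finitely generated. -/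

open scoped TensorProduct in
theorem TensorProduct.quotient_one_tmul_eq_zero_iff {R : Type*} [CommRing R] (I : Ideal R)
    {M : Type*} [AddCommGroup M] [Module R M] (x : M) :
    (1 : R ⧸ I) ⊗ₜ[R] x = 0 ↔ x ∈ I • (⊤ : Submodule R M) := by
  rw [← (quotTensorEquivQuotSMul M I).map_eq_zero_iff, quotTensorEquivQuotSMul_mk_one_tmul,
    Submodule.Quotient.mk_eq_zero]

open scoped TensorProduct in
theorem TensorProduct.exists_eq_quotient_one_tmul {R : Type*} [CommRing R] {I : Ideal R}
    {M : Type*} [AddCommGroup M] [Module R M] (t : (R ⧸ I) ⊗[R] M) :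
    ∃ x : M, t = 1 ⊗ₜ x := by
  obtain ⟨x, hx⟩ := Submodule.Quotient.mk_surjective _ (quotTensorEquivQuotSMul M I t)
  exact ⟨x, by rw [← quotTensorEquivQuotSMul_symm_mk, hx, LinearEquiv.symm_apply_apply]⟩

theorem Ideal.mem_span_range_smul_top_iff {R ι : Type*} [CommRing R] [Fintype ι] (a : ι → R)
    {M : Type*} [AddCommGroup M] [Module R M] (x : M) :
    x ∈ Ideal.span (Set.range a) • (⊤ : Submodule R M) ↔ ∃ y : ι → M, x = ∑ i, a i • y i := by
  constructor
  · intro hx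
    induction hx using Submodule.smul_induction_on' with
    | smul r hr m _ =>
      obtain ⟨c, rfl⟩ := (Ideal.mem_span_range_iff_exists_fun).1 hr
      exact ⟨fun i => c i • m, by simp only [Finset.sum_smul, smul_smul, mul_comm]⟩
    | add u _ v _ hu hv =>
      obtain ⟨y, rfl⟩ := hu
      obtain ⟨z, rfl⟩ := hv
      exact ⟨y + z, by simp [Finset.sum_add_distrib]⟩
  · rintro ⟨y, rfl⟩
    exact Submodule.sum_mem _ fun i _ =>
      Submodule.smul_mem_smul (Ideal.subset_span ⟨i, rfl⟩) trivial

namespace Module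

/-- Lifting x to p in P₀, the relation holds up to a boundary d₁ z, and 1 ⊗ z is a cycle. If it
bounds, z is ∑ aᵢyᵢ modulo the image of d₂, so p − d₁ y is a genuine relation in the flat module P₀.
-/
theorem exact_lTensor_quotient_iff_isTrivialRelation {R : Type*} [CommRing R]
    {M P₀ P₁ P₂ : Type*} [AddCommGroup M] [Module R M] [AddCommGroup P₀] [Module R P₀]
    [AddCommGroup P₁] [Module R P₁] [AddCommGroup P₂] [Module R P₂] [Module.Flat R P₀]
    {d₂ : P₂ →ₗ[R] P₁} {d₁ : P₁ →ₗ[R] P₀} {ε : P₀ →ₗ[R] M}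
    (h₁ : Function.Exact d₂ d₁) (h₀ : Function.Exact d₁ ε) (hε : Function.Surjective ε)
    {ι : Type*} [Fintype ι] (a : ι → R) :
    Function.Exact (d₂.lTensor (R ⧸ Ideal.span (Set.range a)))
      (d₁.lTensor (R ⧸ Ideal.span (Set.range a))) ↔
    ∀ x : ι → M, ∑ i, a i • x i = 0 → IsTrivialRelation a x := by
  constructor
  · intro h x hx
    choose p hp using fun i => hε (x i)
    obtain ⟨z, hz⟩ := (h₀ (∑ i, a i • p i)).1 (by simpa [hp] using hx)
    obtain ⟨t, ht⟩ := (h (1 ⊗ₜ z)).1 (by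
      rw [LinearMap.lTensor_tmul, TensorProduct.quotient_one_tmul_eq_zero_iff,
        Ideal.mem_span_range_smul_top_iff]
      exact ⟨p, hz⟩)
    obtain ⟨w, rfl⟩ := TensorProduct.exists_eq_quotient_one_tmul t
    rw [LinearMap.lTensor_tmul, eq_comm, ← sub_eq_zero, ← TensorProduct.tmul_sub,
      TensorProduct.quotient_one_tmul_eq_zero_iff, Ideal.mem_span_range_smul_top_iff] at ht
    obtain ⟨y, hy⟩ := ht
    have hdz : d₁ z = ∑ i, a i • d₁ (y i) := by
      have := congrArg d₁ hy
      simpa [h₁.apply_apply_eq_zero] using this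
    obtain ⟨k, r, q, hq, hr⟩ := Flat.isTrivialRelation_of_sum_smul_eq_zero
      (f := a) (x := fun i => p i - d₁ (y i)) (by
        simp only [smul_sub, Finset.sum_sub_distrib]
        rw [← hz, ← hdz, sub_self])
    refine ⟨k, r, fun j => ε (q j), fun i => ?_, hr⟩
    have := congrArg ε (hq i)
    simpa [h₀.apply_apply_eq_zero, hp] using this
  · intro h t
    constructor
    · intro ht
      obtain ⟨z, rfl⟩ := TensorProduct.exists_eq_quotient_one_tmul t
      rw [LinearMap.lTensor_tmul, TensorProduct.quotient_one_tmul_eq_zero_iff,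
        Ideal.mem_span_range_smul_top_iff] at ht
      obtain ⟨p, hp⟩ := ht
      obtain ⟨k, r, y, hy, hr⟩ := h (fun i => ε (p i)) (by
        have := congrArg ε hp
        rw [h₀.apply_apply_eq_zero] at this
        simpa using this.symm)
      choose q hq using fun j => hε (y j)
      -- The trivialization in M lifts to P₀ up to d₁ vᵢ. Its syzygy part is killed by a, so z − ∑
      -- aᵢvᵢ lies in the kernel of d₁.
      choose v hv using fun i => (h₀ (p i - ∑ j, r i j • q j)).1 (by simp [hq, hy])
      have hrel : ∑ i, a i • ∑ j, r i j • q j = 0 := by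
        simp only [Finset.smul_sum, smul_smul]
        rw [Finset.sum_comm]
        simp [← Finset.sum_smul, hr]
      obtain ⟨w, hw⟩ := (h₁ (z - ∑ i, a i • v i)).1 (by
        simp [hv, smul_sub, hrel, hp])
      refine ⟨1 ⊗ₜ w, ?_⟩
      rw [LinearMap.lTensor_tmul, eq_comm, ← sub_eq_zero, ← TensorProduct.tmul_sub,
        TensorProduct.quotient_one_tmul_eq_zero_iff, Ideal.mem_span_range_smul_top_iff]
      exact ⟨v, by rw [hw]; abel⟩
    · rintro ⟨s, rfl⟩
      rw [← LinearMap.comp_apply, ← LinearMap.lTensor_comp, h₁.linearMap_comp_eq_zero,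
        LinearMap.lTensor_zero, LinearMap.zero_apply]

end Module

open Module in
theorem isZero_tor_one_iff_isTrivialRelation {R : Type u} [CommRing R] (M : ModuleCat.{u} R)
    {ι : Type*} [Fintype ι] (a : ι → R) :
    Limits.IsZero (((Tor (ModuleCat.{u} R) 1).obj
      (ModuleCat.of R (R ⧸ Ideal.span (Set.range a)))).obj M) ↔
    ∀ x : ι → M, ∑ i, a i • x i = 0 → IsTrivialRelation a x := by
  let P := projectiveResolution M
  let F := (MonoidalCategory.tensoringLeft (ModuleCat.{u} R)).obj
    (ModuleCat.of R (R ⧸ Ideal.span (Set.range a)))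
  have : Module.Flat R (P.complex.X 0) :=
    have := (IsProjective.iff_projective (P.complex.X 0)).2 (P.projective 0)
    inferInstance
  have h₁ := (ShortComplex.ShortExact.moduleCat_exact_iff_function_exact _).1 (P.exact_succ 0)
  have h₀ := (ShortComplex.ShortExact.moduleCat_exact_iff_function_exact _).1 P.exact₀
  have hε : Function.Surjective (P.π.f 0).hom :=
    (ModuleCat.epi_iff_surjective _).1 inferInstance
  refine Iff.trans ?_ (exact_lTensor_quotient_iff_isTrivialRelation (M := M) h₁ h₀ hε a)
  refine (P.isoLeftDerivedObj F 1).isZero_iff.trans ?_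
  refine (HomologicalComplex.exactAt_iff_isZero_homology _ _).symm.trans ?_
  rw [HomologicalComplex.exactAt_iff' _ 2 1 0 (by simp) (by simp)]
  exact ShortComplex.ShortExact.moduleCat_exact_iff_function_exact _

theorem Ideal.exists_surjective_span_range {R ι : Type*} [CommRing R] [Fintype ι] (a : ι → R) :
    ∃ l : (ι → R) →ₗ[R] Ideal.span (Set.range a), Function.Surjective l ∧
      ∀ c, c ∈ LinearMap.ker l ↔ ∑ i, a i * c i = 0 := by
  let l : (ι → R) →ₗ[R] Ideal.span (Set.range a) :=
    (Fintype.linearCombination R a).codRestrict _ fun c => by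
      rw [← Ideal.submodule_span_eq, ← Fintype.range_linearCombination]
      exact ⟨c, rfl⟩
  refine ⟨l, ?_, fun c => ?_⟩
  · rintro ⟨r, hr⟩
    obtain ⟨c, hc⟩ := Ideal.mem_span_range_iff_exists_fun.1 hr
    exact ⟨c, Subtype.ext (by simpa [l, Fintype.linearCombination_apply] using hc)⟩
  · rw [LinearMap.mem_ker, ← Subtype.coe_inj]
    simp [l, Fintype.linearCombination_apply, mul_comm]

namespace Module

/-- Every relation `∑ aᵢ xᵢ = 0` in `M` whose coefficients generate an ideal in `S` is trivial. -/
def RelationsTrivial {R : Type*} [CommRing R] (S : Set (Ideal R)) (M : Type*) [AddCommGroup M]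
    [Module R M] : Prop :=
  ∀ ⦃n : ℕ⦄ (a : Fin n → R) (x : Fin n → M), Ideal.span (Set.range a) ∈ S →
    ∑ i, a i • x i = 0 → IsTrivialRelation a x

namespace RelationsTrivial

variable {R : Type*} [CommRing R] {S : Set (Ideal R)}
  {M N : Type*} [AddCommGroup M] [Module R M] [AddCommGroup N] [Module R N]

theorem of_flat [Module.Flat R M] : RelationsTrivial S M :=
  fun _ _ _ _ h => Flat.isTrivialRelation_of_sum_smul_eq_zero h

theorem of_retract (h : RelationsTrivial S N) (s : M →ₗ[R] N) (p : N →ₗ[R] M)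
    (hps : ∀ m, p (s m) = m) : RelationsTrivial S M := by
  intro n a x ha hx
  obtain ⟨k, r, y, hy, hr⟩ := h a (fun i => s (x i)) ha (by
    simpa using congrArg s hx)
  refine ⟨k, r, fun j => p (y j), fun i => ?_, hr⟩
  simpa [hps] using congrArg p (hy i)

theorem pi (hS : ∀ I ∈ S, I.FG → FinitePresentation R I) {ι : Type*} {M : ι → Type*}
    [∀ i, AddCommGroup (M i)] [∀ i, Module R (M i)] (h : ∀ i, RelationsTrivial S (M i)) :
    RelationsTrivial S (∀ i, M i) := by
  intro n a x ha hx
  have := hS _ ha (Submodule.fg_span (Set.finite_range a))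
  obtain ⟨l, hl, hker⟩ := Ideal.exists_surjective_span_range a
  obtain ⟨k, s, hs⟩ := Submodule.fg_iff_exists_fin_generating_family.1
    (FinitePresentation.fg_ker l hl)
  -- The generating syzygies s do not depend on the factor i; only the vectors z are chosen
  -- factorwise.
  have key (i : ι) : ∃ z : Fin k → M i, ∀ m, x m i = ∑ t, s t m • z t := by
    obtain ⟨q, b, y, hy, hb⟩ := h i a (fun m => x m i) ha (by simpa using congrFun hx i)
    have hcol (j : Fin q) : ∃ c : Fin k → R, ∑ t, c t • s t = fun m => b m j := by
      rw [← Submodule.mem_span_range_iff_exists_fun, hs, hker]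
      exact hb j
    choose c hc using hcol
    refine ⟨fun t => ∑ j, c j t • y j, fun m => ?_⟩
    refine (hy m).trans ?_
    simp only [Finset.smul_sum, smul_smul]
    rw [Finset.sum_comm]
    refine Finset.sum_congr rfl fun j _ => ?_
    rw [← Finset.sum_smul, ← congrFun (hc j) m]
    simp [mul_comm]
  choose z hz using key
  refine ⟨k, fun m t => s t m, fun t i => z i t, fun m => funext fun i => ?_, fun t => ?_⟩
  · simpa using hz i m
  · exact (hker _).1 (hs ▸ Submodule.subset_span ⟨t, rfl⟩)

end RelationsTrivial

theorem finitePresentation_span_range_of_isTrivialRelation_pi {R : Type*} [CommRing R]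
    {ι : Type*} [Fintype ι] (a : ι → R)
    (h : ∀ x : ι → {c : ι → R // ∑ i, a i * c i = 0} → R,
      ∑ i, a i • x i = 0 → IsTrivialRelation a x) :
    FinitePresentation R (Ideal.span (Set.range a)) := by
  obtain ⟨l, hl, hker⟩ := Ideal.exists_surjective_span_range a
  -- Coordinate c of this relation is the syzygy c itself. A trivialization read at c writes c as a
  -- combination of the k columns of b.
  obtain ⟨k, b, y, hy, hb⟩ := h (fun i c => c.1 i) (by
    ext c
    simpa using c.2)
  refine finitePresentation_of_surjective l hl ?_
  refine Submodule.fg_iff_exists_fin_generating_family.2 ⟨k, fun j i => b i j, ?_⟩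
  refine le_antisymm (Submodule.span_le.2 ?_) fun c hc => ?_
  · rintro _ ⟨j, rfl⟩
    exact (hker _).2 (hb j)
  · rw [Submodule.mem_span_range_iff_exists_fun]
    refine ⟨fun j => y j ⟨c, (hker c).1 hc⟩, funext fun i => ?_⟩
    have := congrFun (hy i) ⟨c, (hker c).1 hc⟩
    simp only [Finset.sum_apply, Pi.smul_apply, smul_eq_mul] at this ⊢
    rw [this]
    simp only [mul_comm]

/-- Formal terms built from elements of `M` by the module operations and by symbols
`witness a x j` for the vectors that trivialize the relation between `a` and `x`. -/
inductive RelationTerm (R M : Type u) : Type u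
  | of (m : M) : RelationTerm R M
  | add (s t : RelationTerm R M) : RelationTerm R M
  | smul (r : R) (t : RelationTerm R M) : RelationTerm R M
  | witness {n : ℕ} (a : Fin n → R) (x : Fin n → RelationTerm R M) (j : ℕ) : RelationTerm R M

namespace RelationTerm

variable {R M : Type u} [CommRing R] [AddCommGroup M] [Module R M]
  {N : Type*} [AddCommGroup N] [Module R N]

/-- Evaluation of terms in `N`, given a map on `M` and an interpretation of the witnesses. -/
def eval (g : M → N) (w : ∀ n : ℕ, (Fin n → R) → (Fin n → N) → ℕ → N) : RelationTerm R M → N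
  | of m => g m
  | add s t => eval g w s + eval g w t
  | smul r t => r • eval g w t
  | witness (n := n) a x j => w n a (fun i => eval g w (x i)) j

/-- The values of all terms, as a submodule. -/
def evalRange (g : M →ₗ[R] N) (w : ∀ n : ℕ, (Fin n → R) → (Fin n → N) → ℕ → N) :
    Submodule R N where
  carrier := Set.range (eval g w)
  add_mem' := by
    rintro _ _ ⟨s, rfl⟩ ⟨t, rfl⟩
    exact ⟨add s t, rfl⟩
  zero_mem' := ⟨of 0, by simp [eval]⟩
  smul_mem' := by
    rintro r _ ⟨t, rfl⟩
    exact ⟨smul r t, rfl⟩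

end RelationTerm

/-- A homomorphism to a module in which the relations are trivial factors through a module with
the same property, which is a quotient of a free module depending only on the source. -/
theorem RelationsTrivial.exists_factorization {R M : Type u} [CommRing R] [AddCommGroup M]
    [Module R M] {N : Type*} [AddCommGroup N] [Module R N] {S : Set (Ideal R)}
    (hN : RelationsTrivial S N) (g : M →ₗ[R] N) :
    ∃ K : Submodule R (RelationTerm R M →₀ R),
      RelationsTrivial S ((RelationTerm R M →₀ R) ⧸ K) ∧
      ∃ (f : M →ₗ[R] (RelationTerm R M →₀ R) ⧸ K) (h : (RelationTerm R M →₀ R) ⧸ K →ₗ[R] N),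
        h ∘ₗ f = g := by
  classical
  have key (n : ℕ) (a : Fin n → R) (x : Fin n → N) :
      ∃ w : ℕ → N, Ideal.span (Set.range a) ∈ S → ∑ i, a i • x i = 0 →
        ∃ (k : ℕ) (r : Fin n → Fin k → R),
          (∀ i, x i = ∑ j, r i j • w j) ∧ ∀ j, ∑ i, a i * r i j = 0 := by
    by_cases h : Ideal.span (Set.range a) ∈ S ∧ ∑ i, a i • x i = 0
    · obtain ⟨k, r, y, hy, hr⟩ := hN a x h.1 h.2
      -- Witnesses are indexed by ℕ because k varies with the relation; the zeros from k on are
      -- padding.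
      exact ⟨fun j => if hj : j < k then y ⟨j, hj⟩ else 0, fun _ _ => ⟨k, r, by simpa, hr⟩⟩
    · exact ⟨0, fun h₁ h₂ => (h ⟨h₁, h₂⟩).elim⟩
  choose w hw using key
  let E := RelationTerm.evalRange g w
  have hE : RelationsTrivial S E := by
    intro n a x ha hx
    choose t ht using fun i => (x i).2
    obtain ⟨k, r, hr, hr'⟩ := hw n a (fun i => (x i : N)) ha (by
      simpa using congrArg E.subtype hx)
    -- The trivializing vectors are values of `witness` terms, hence stay in E.
    refine ⟨k, r, fun j => ⟨w n a (fun i => (x i : N)) j, .witness a t j, ?_⟩, fun i => ?_, hr'⟩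
    · simp only [RelationTerm.eval, ht]
    · exact Subtype.ext (by simpa using hr i)
  let p : (RelationTerm R M →₀ R) →ₗ[R] E :=
    Finsupp.linearCombination R fun t => ⟨RelationTerm.eval g w t, t, rfl⟩
  have hp : Function.Surjective p := by
    rintro ⟨_, t, rfl⟩
    exact ⟨Finsupp.single t 1, by simp [p]⟩
  let e := p.quotKerEquivOfSurjective hp
  refine ⟨LinearMap.ker p, hE.of_retract e e.symm (by simp),
    e.symm.toLinearMap ∘ₗ g.codRestrict E fun m => ⟨.of m, rfl⟩, E.subtype ∘ₗ e.toLinearMap, ?_⟩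
  exact LinearMap.ext fun m => congrArg Subtype.val (e.apply_symm_apply _)

/-- If the relations are trivial in products, then every module has a weakly universal map to a
module in which they are trivial. -/
theorem exists_relationsTrivial_preenvelope {R : Type u} [CommRing R] (M : Type u)
    [AddCommGroup M] [Module R M] {S : Set (Ideal R)} (hS : ∀ I ∈ S, I.FG → FinitePresentation R I) :
    ∃ (F : Type u) (_ : AddCommGroup F) (_ : Module R F) (f : M →ₗ[R] F), RelationsTrivial S F ∧
      ∀ (N : Type u) [AddCommGroup N] [Module R N], RelationsTrivial S N →
        ∀ g : M →ₗ[R] N, ∃ h : F →ₗ[R] N, h ∘ₗ f = g := by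
  -- The free module depends only on M, so all candidate targets form a set in universe u.
  let ι := Σ K : {K : Submodule R (RelationTerm R M →₀ R) //
    RelationsTrivial S ((RelationTerm R M →₀ R) ⧸ K)}, M →ₗ[R] (RelationTerm R M →₀ R) ⧸ K.1
  let Q (i : ι) : Type u := (RelationTerm R M →₀ R) ⧸ i.1.1
  let _ (i : ι) : AddCommGroup (Q i) := Submodule.Quotient.addCommGroup i.1.1
  let _ (i : ι) : Module R (Q i) := Submodule.Quotient.module i.1.1
  refine ⟨∀ i, Q i, inferInstance, inferInstance, LinearMap.pi (φ := Q) fun i => i.2,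
    .pi hS fun i => i.1.2, fun N _ _ hN g => ?_⟩
  obtain ⟨K, hK, f, h, hf⟩ := hN.exists_factorization g
  exact ⟨h ∘ₗ LinearMap.proj (φ := Q) (⟨⟨K, hK⟩, f⟩ : ι), hf⟩

end Module

theorem semiregularFlat_iff_relationsTrivial {R : Type u} [CommRing R] (M : ModuleCat.{u} R) :
    semiregularFlat R M ↔
      Module.RelationsTrivial {I : Ideal R | I.IsSemiregularIdeal} M := by
  constructor
  · intro h n a x ha hx
    exact (isZero_tor_one_iff_isTrivialRelation M a).1
      (h _ (Submodule.fg_span (Set.finite_range a)) ha) x hx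
  · intro h I hI hI'
    obtain ⟨n, a, rfl⟩ := Submodule.fg_iff_exists_fin_generating_family.1 hI
    exact (isZero_tor_one_iff_isTrivialRelation M a).2 fun x hx => h a x hI' hx

/-- The projections extend along a preenvelope of the product and assemble to a retraction, so the
product is a retract of a member of the class. -/
theorem semiregularFlat_pi_of_isPreenveloping {R : Type u} [CommRing R]
    (h : (semiregularFlat R).IsPreenveloping) {ι : Type u} (M : ι → ModuleCat.{u} R)
    (hM : ∀ i, semiregularFlat R (M i)) :
    semiregularFlat R (ModuleCat.of R (∀ i, M i)) := by
  obtain ⟨F, f, hF, hf⟩ := h (ModuleCat.of R (∀ i, M i))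
  choose p hp using fun i => hf (M i) (hM i) (ModuleCat.ofHom (LinearMap.proj i))
  rw [semiregularFlat_iff_relationsTrivial] at hF ⊢
  refine hF.of_retract f.hom (LinearMap.pi fun i => (p i).hom) fun m => funext fun i => ?_
  exact congrArg (fun q => q.hom m) (hp i)

theorem lemma4p5 (R : Type u) [CommRing R] :
    IsSemiregularCoherent R ↔ (semiregularFlat R).IsPreenveloping := by
  constructor
  · intro hR M
    obtain ⟨F, _, _, f, hF, hf⟩ := Module.exists_relationsTrivial_preenvelope M
      (S := {I : Ideal R | I.IsSemiregularIdeal}) fun I hI hfg => hR I hfg hI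
    refine ⟨ModuleCat.of R F, ModuleCat.ofHom f,
      (semiregularFlat_iff_relationsTrivial _).2 hF, fun N hN g => ?_⟩
    obtain ⟨h, hh⟩ := hf N ((semiregularFlat_iff_relationsTrivial _).1 hN) g.hom
    exact ⟨ModuleCat.ofHom h, ModuleCat.hom_ext hh⟩
  · intro h I hI hI'
    obtain ⟨n, a, rfl⟩ := Submodule.fg_iff_exists_fin_generating_family.1 hI
    refine Module.finitePresentation_span_range_of_isTrivialRelation_pi a fun x hx => ?_
    have hpi := semiregularFlat_pi_of_isPreenveloping h
      (fun _ : {c : Fin n → R // ∑ i, a i * c i = 0} => ModuleCat.of R R)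
      fun _ => (semiregularFlat_iff_relationsTrivial _).2 .of_flat
    exact (semiregularFlat_iff_relationsTrivial _).1 hpi a x hI' hx
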